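/- All digraphs are finite and have no loops and no parallel arcs; a digon is a pair of opposite arcs $(u,v),(v,u)$. The dichromatic number $\vec{\chi}(D)$ of a digraph $D$ is the smallest $k$ such that $V(D)$ can be partitioned into $k$ (possibly empty) classes each inducing a subdigraph without directed cycles. For a digraph $F$, $\operatorname{mader}_{\vec{\chi}}(F)$ is the smallest integer $M$ such that every digraph $D$ with $\vec{\chi}(D)\ge M$ contains a subdivision of $F$ as a subdigraph (with $\operatorname{mader}_{\vec\chi}(F)=\infty$ if there were no such $M$). For $k\ge 1$ let $\mathcal{S}_k$ be the set of good digraphs $Q$, that is, of those digraphs $Q$ with vertex set $\{v_1,\dots,v_k\}$ such that every arc of $Q$ joins two consecutive vertices $v_i,v_{i+1}$ (in either direction), the underlying graph of $Q$ is connected, the digons of $Q$ are pairwise vertex-disjoint, and, if $k\ge 2$, exactly one arc of $Q$ is incident with $v_1$, i.e. $d_Q^+(v_1)+d_Q^-(v_1)=1$. (So $\mathcal{S}_1$ consists of the one-vertex digraph.) **Theorem 3.1.** Let $F$ be a digraph, $v_0\in V(F)$, $k\ge 1$, and let $Q\in\mathcal{S}_k$ be vertex-disjoint from $F$. Let $F^*$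 be obtained from the disjoint union of $F$ and $Q$ by adding both arcs $(v_0,v_1)$ and $(v_1,v_0)$ and, if $k\ge 2$, exactly one of the arcs $(v_0,v_k)$, $(v_k,v_0)$. Then $$\operatorname{mader}_{\vec{\chi}}(F^*)\le \operatorname{mader}_{\vec{\chi}}(F)+k .$$ -/

import Mathlib

namespace DigraphSubdivision

/-- A digraph without loops. (`Digraph` has no parallel arcs; two opposite arcs are allowed.) -/
def Loopless {V : Type*} (D : Digraph V) : Prop :=
  ∀ v, ¬ D.Adj v v

/-- The list `l` is the sequence of vertices of a dipath of `D` from `u` to `v`. -/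
def IsDipath {V : Type*} (D : Digraph V) (u v : V) (l : List V) : Prop :=
  l.Nodup ∧ l.IsChain D.Adj ∧ l.head? = some u ∧ l.getLast? = some v

/-- The list `l` is the sequence of vertices of a dicycle of `D`: a dipath together with
an arc from its last vertex to its first vertex. -/
def IsDicycle {V : Type*} (D : Digraph V) (l : List V) : Prop :=
  ∃ u v, IsDipath D u v l ∧ D.Adj v u

/-- The vertex set `S` induces an acyclic subdigraph of `D`. -/
def InducesAcyclic {V : Type*} (D : Digraph V) (S : Set V) : Prop :=
  ∀ l, IsDicycle D l → ¬ ∀ x ∈ l, x ∈ S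

/-- `c` is an acyclic `k`-coloring of `D`: every color class induces an acyclic subdigraph. -/
def IsAcyclicColoring {V : Type*} (D : Digraph V) {k : ℕ} (c : V → Fin k) : Prop :=
  ∀ i, InducesAcyclic D (c ⁻¹' {i})

/-- The dichromatic number of `D` (meant for finite loopless digraphs, which always have an
acyclic coloring): the smallest `k` such that `D` has an acyclic `k`-coloring. -/
noncomputable def dichromaticNumber {V : Type*} (D : Digraph V) : ℕ :=
  sInf {k : ℕ | ∃ c : V → Fin k, IsAcyclicColoring D c}

/-- `D` contains a subdivision of `F` as a subdigraph: there are distinct branch vertices `f v` and,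
for every arc `(u, v)` of `F`, a dipath `P u v` of `D` from `f u` to `f v`, such that a dipath
contains no branch vertex except its two ends, and any two of the dipaths meet only in branch
vertices. -/
def ContainsSubdivision {V W : Type*} (F : Digraph V) (D : Digraph W) : Prop :=
  ∃ (f : V → W) (P : V → V → List W),
    Function.Injective f ∧
    (∀ u v, F.Adj u v → IsDipath D (f u) (f v) (P u v)) ∧
    (∀ u v, F.Adj u v → ∀ w, f w ∈ P u v → w = u ∨ w = v) ∧
    (∀ u v u' v', F.Adj u v → F.Adj u' v' → (u, v) ≠ (u', v') →
      ∀ x, x ∈ P u v → x ∈ P u' v' → x ∈ Set.range f)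

/-- Every finite loopless digraph with dichromatic number at least `M` contains a subdivision
of `F`. -/
def Forces {V : Type*} (F : Digraph V) (M : ℕ) : Prop :=
  ∀ (W : Type) [Finite W] (D : Digraph W), Loopless D → M ≤ dichromaticNumber D →
    ContainsSubdivision F D

/-- The Mader number of `F` with respect to the dichromatic number: the smallest `M` such that every
digraph with dichromatic number at least `M` contains a subdivision of `F` (and `⊤` if there
were no such `M`, so that no junk value can occur). -/
noncomputable def mader {V : Type*} (F : Digraph V) : ℕ∞ :=
  sInf ((fun M : ℕ => (M : ℕ∞)) '' {M : ℕ | Forces F M})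

/-- The biorientation of a simple graph: each edge becomes a pair of opposite arcs. -/
def biorientation {V : Type*} (G : SimpleGraph V) : Digraph V where
  Adj := G.Adj

/-- `u` and `v` are joined by a digon, i.e. by a pair of opposite arcs. -/
def IsDigon {V : Type*} (D : Digraph V) (u v : V) : Prop :=
  D.Adj u v ∧ D.Adj v u

/-- The sum of the out-degree and the in-degree of `v`. -/
noncomputable def totalDegree {V : Type*} (D : Digraph V) (v : V) : ℕ :=
  {w | D.Adj v w}.ncard + {w | D.Adj w v}.ncard

/-- Good subdigraphs `Q` of the biorientation of the path `v₁ v₂ … v_k`, where `v_i` is the element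
`i - 1` of `Fin k`: `Q` is spanning and connected, its digons are pairwise vertex-disjoint, and
`v₁` is incident with exactly one arc. For `k = 1` there is no arc and the last condition is
void, so that the one-vertex digraph is good. -/
structure IsGood {k : ℕ} (Q : Digraph (Fin k)) : Prop where
  le_path : Q ≤ biorientation (SimpleGraph.pathGraph k)
  connected : Q.toSimpleGraphInclusive.Connected
  digons_disjoint : ∀ a b c d, IsDigon Q a b → IsDigon Q c d →
    s(a, b) ≠ s(c, d) → Disjoint ({a, b} : Set (Fin k)) {c, d}
  degree_first : ∀ h : 2 ≤ k, totalDegree Q ⟨0, by omega⟩ = 1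

/-- The digraph obtained from the disjoint union of `F` and `Q` by adding both arcs `(v₀, v₁)` and
`(v₁, v₀)` and, if `k ≥ 2`, one arc between `v₀` and `v_k`, namely `(v₀, v_k)` if
`out = true` and `(v_k, v₀)` if `out = false`. -/
def attach {V : Type*} (F : Digraph V) (v₀ : V) {k : ℕ} (Q : Digraph (Fin k)) (out : Bool) :
    Digraph (V ⊕ Fin k) where
  Adj
    | .inl u, .inl v => F.Adj u v
    | .inr i, .inr j => Q.Adj i j
    | .inl u, .inr j =>
        u = v₀ ∧ (j.val = 0 ∨ (2 ≤ k ∧ out = true ∧ j.val + 1 = k))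
    | .inr i, .inl v =>
        v = v₀ ∧ (i.val = 0 ∨ (2 ≤ k ∧ out = false ∧ i.val + 1 = k))

end DigraphSubdivision

/-!
Let `D` have dichromatic number at least `M + k`, where `M` forces subdivisions of `F`, and let `S` be
a maximal vertex set with an acyclic `k`-colouring. The subdigraph outside `S` has dichromatic number
at least `M`, so it contains a subdivision of `F`; let `x` be the image of `v₀`. By maximality
`S ∪ {x}` has no acyclic `k`-colouring. It remains to find in `S ∪ {x}` a subdivision of the oriented
cycle `v₀ v₁ … v_k v₀` in which `v₀` is mapped to `x` (`exists_cycle`); it meets the subdivision of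
`F` only in `x`.

For this, colour `S` with `1, …, k` and give `x` the colour `0`. Starting with `seed 0 = {x}`, vertices
are marked colour by colour. If the link between `vᵢ` and `vᵢ₊₁` is a single arc, the marked vertices
of colour `i` are closed under walks in their colour class in the direction of the arc (`spread`),
and their neighbours of colour `i + 1` in this direction form `seed (i + 1)`. If the link is a digon,
the strong components, in the union of the colours `i` and `i + 1`, of the vertices of `seed i` are
marked, and their vertices of colour `i + 1` form `seed (i + 1)`.

Every vertex of `seed i` ends a subdivision of the path `v₀ v₁ … vᵢ` that consists of marked vertices
(`exists_partialCycle`). For a digon, the strong component contains a cycle through the new end and a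
path from the old end to that cycle; this path prolongs the previous link, which is a single arc
because digons are disjoint. For the digon between `v₀` and `v₁` the cycle has to pass through `x`, as
the class of colour `1` is acyclic.

Finally, the subdivision of the whole cycle is closed by a path from `seed k` to `x` in the direction
of the last link, which avoids the marked vertices of colours less than `k`
(`exists_closing_walk`). Suppose there is none, and let `B` be the set of vertices that can be reached
from `seed k` in this way. Raise the colours of the marked vertices and of the vertices of `B` by one,
except that the vertices of `B` of colour `k` get the colour `1`. The closure properties of the marked
sets and of `B` keep all colour classes acyclic, including the class of colour `1`, which now contains
`x`. This is an acyclic colouring of `S ∪ {x}` with `k` colours, a contradiction.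
-/

namespace DigraphSubdivision

open Relation

/-! ### Walks inside a vertex set and acyclic vertex sets -/


/-- The restriction of the relation `r` to the set `T`. -/
def Within {W : Type*} (r : W → W → Prop) (T : Set W) (a b : W) : Prop :=
  r a b ∧ a ∈ T ∧ b ∈ T

/-- There is a (possibly trivial) walk from `a` to `b` along `r` inside `T`. The trivial walk is
allowed even if its vertex is not in `T`. -/
def Conn {W : Type*} (r : W → W → Prop) (T : Set W) : W → W → Prop :=
  ReflTransGen (Within r T)

/-- No arc of `r` inside `T` lies on a closed walk inside `T`. -/
def Acyc {W : Type*} (r : W → W → Prop) (T : Set W) : Prop :=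
  ∀ a b, Within r T a b → ¬ Conn r T b a

section Walks

variable {W : Type*} {r : W → W → Prop} {S T H : Set W} {a b c : W}

theorem Within.mono (h : S ⊆ T) (hab : Within r S a b) : Within r T a b :=
  ⟨hab.1, h hab.2.1, h hab.2.2⟩

theorem Conn.mono (h : S ⊆ T) (hab : Conn r S a b) : Conn r T a b :=
  ReflTransGen.mono (fun _ _ => Within.mono h) _ _ hab

theorem Conn.trans (hab : Conn r T a b) (hbc : Conn r T b c) : Conn r T a c :=
  ReflTransGen.trans hab hbc

theorem Conn.single (h : r a b) (ha : a ∈ T) (hb : b ∈ T) : Conn r T a b :=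
  ReflTransGen.single ⟨h, ha, hb⟩

theorem conn_swap : Conn (Function.swap r) T a b ↔ Conn r T b a := by
  have : Within (Function.swap r) T = Function.swap (Within r T) := by
    funext a b
    simp only [Within, Function.swap, eq_iff_iff]
    tauto
  rw [Conn, this, reflTransGen_swap]
  rfl

theorem acyc_swap : Acyc (Function.swap r) T ↔ Acyc r T := by
  constructor
  · intro h a b hab hba
    exact h b a ⟨hab.1, hab.2.2, hab.2.1⟩ (conn_swap.2 hba)
  · intro h a b hab hba
    exact h b a ⟨hab.1, hab.2.2, hab.2.1⟩ (conn_swap.1 hba)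

theorem Acyc.mono (h : S ⊆ T) (hT : Acyc r T) : Acyc r S :=
  fun _ _ hab hba => hT _ _ (hab.mono h) (hba.mono h)

theorem Acyc.eq_of_conn (hT : Acyc r T) (hab : Conn r T a b) (hba : Conn r T b a) : a = b := by
  rcases ReflTransGen.cases_head hab with h | ⟨c, hac, hcb⟩
  · exact h
  · exact absurd (Conn.trans hcb hba) (hT _ _ hac)

theorem Conn.mem (h : Conn r T a b) (ha : a ∈ T) : b ∈ T := by
  rcases ReflTransGen.cases_tail h with h | ⟨c, _, hc⟩
  · exact h ▸ ha
  · exact hc.2.2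

theorem acyc_of_subsingleton (hr : ∀ v, ¬ r v v) (hT : T.Subsingleton) : Acyc r T := by
  intro a b hab _
  have := hT hab.2.1 hab.2.2
  subst this
  exact hr _ hab.1

/-- A walk stays inside every set that contains all the vertices through which a walk between the
same ends can pass. -/
theorem Conn.restrict (h : Conn r T a b)
    (hS : ∀ w, Conn r T a w → Conn r T w b → w ∈ S) : Conn r S a b := by
  induction h using ReflTransGen.head_induction_on with
  | refl => exact ReflTransGen.refl
  | head hac hcb ih =>
    rename_i p q
    have hpq : Conn r T p q := ReflTransGen.single hac
    refine ReflTransGen.head ⟨hac.1, hS _ ReflTransGen.refl (hpq.trans hcb), hS _ hpq hcb⟩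
      (ih fun w h1 h2 => hS w (hpq.trans h1) h2)

/-- If every closed walk of `T` that meets `A` stays inside `A`, then acyclicity can be checked on
`A` and on `T \ A`. -/
theorem acyc_of_absorb {A : Set W} (hA : Acyc r A) (hTA : Acyc r (T \ A))
    (h : ∀ u ∈ A, ∀ w ∈ T, Conn r T u w → Conn r T w u → w ∈ A) : Acyc r T := by
  intro a b hab hba
  have hab' : Conn r T a b := ReflTransGen.single hab
  have memT : ∀ w, Conn r T b w → w ∈ T := fun w hw => hw.mem hab.2.2
  by_cases ha : a ∈ A
  · refine hA a b ⟨hab.1, ha, h a ha b hab.2.2 hab' hba⟩ (hba.restrict fun w h1 h2 => ?_)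
    exact h a ha w (memT w h1) (hab'.trans h1) h2
  · have hb : b ∉ A := fun hb => ha (h b hb a hab.2.1 hba hab')
    refine hTA a b ⟨hab.1, ⟨hab.2.1, ha⟩, hab.2.2, hb⟩ (hba.restrict fun w h1 h2 => ?_)
    exact ⟨memT w h1, fun hw => ha (h w hw a hab.2.1 h2 (hab'.trans h1))⟩

theorem acyc_of_no_arc {A : Set W} (hA : Acyc r A) (hTA : Acyc r (T \ A))
    (h : ∀ u ∈ A, ∀ w ∈ T, r u w → w ∈ A) : Acyc r T := by
  refine acyc_of_absorb hA hTA fun u hu w _ huw _ => ?_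
  clear * - h hu huw
  induction huw with
  | refl => exact hu
  | tail _ hpq ih => exact h _ ih _ hpq.2.2 hpq.1

/-- A walk that ends in `H` has an initial segment that meets `H` only in its last vertex. -/
theorem Conn.first_hit (h : Conn r T a b) (hb : b ∈ H) :
    ∃ u ∈ H, Conn r (insert u (T \ H)) a u := by
  induction h using ReflTransGen.head_induction_on with
  | refl => exact ⟨b, hb, ReflTransGen.refl⟩
  | head hac hcb ih =>
    rename_i p q
    by_cases hp : p ∈ H
    · exact ⟨p, hp, ReflTransGen.refl⟩
    by_cases hq : q ∈ H
    · exact ⟨q, hq, Conn.single hac.1 (Or.inr ⟨hac.2.1, hp⟩) (Or.inl rfl)⟩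
    obtain ⟨u, hu, hqu⟩ := ih
    exact ⟨u, hu, (Conn.single hac.1 (Or.inr ⟨hac.2.1, hp⟩) (Or.inr ⟨hac.2.2, hq⟩)).trans hqu⟩

/-- A walk that starts in `H` has a final segment that meets `H` only in its first vertex. -/
theorem Conn.last_exit (h : Conn r T a b) (ha : a ∈ H) :
    ∃ u ∈ H, Conn r (insert u (T \ H)) u b := by
  obtain ⟨u, hu, h'⟩ := (conn_swap.2 h : Conn (Function.swap r) T b a).first_hit ha
  exact ⟨u, hu, conn_swap.1 h'⟩

/-! ### Dipaths and walks -/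

theorem conn_of_isChain {l : List W} (hl : l.IsChain r) (ha : l.head? = some a)
    (hb : l.getLast? = some b) : Conn r {x | x ∈ l} a b := by
  induction l generalizing a with
  | nil => simp at ha
  | cons p l ih =>
    obtain rfl : p = a := by simpa using ha
    cases l with
    | nil =>
      obtain rfl : p = b := by simpa using hb
      exact ReflTransGen.refl
    | cons q l =>
      rw [List.isChain_cons_cons] at hl
      have h2 := ih hl.2 (a := q) rfl (by simpa using hb)
      exact (Conn.single hl.1 (by simp) (by simp)).trans
        (h2.mono fun x hx => List.mem_cons_of_mem _ hx)

theorem exists_isDipath_of_conn (h : Conn r T a b) (hb : b ∈ T) :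
    ∃ l, IsDipath ⟨r⟩ a b l ∧ ∀ x ∈ l, x ∈ T := by
  induction h using ReflTransGen.head_induction_on with
  | refl => exact ⟨[b], ⟨by simp, by simp, rfl, rfl⟩, by simpa using hb⟩
  | head hac hcb ih =>
    rename_i p q
    obtain ⟨l, ⟨hnd, hch, hh, hlast⟩, hT⟩ := ih
    by_cases hp : p ∈ l
    · obtain ⟨s, t, rfl⟩ := List.append_of_mem hp
      refine ⟨p :: t, ⟨?_, ?_, rfl, ?_⟩, fun x hx => hT x (List.mem_append_right _ hx)⟩
      · exact (List.nodup_append.1 hnd).2.1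
      · exact (List.isChain_append.1 hch).2.1
      · simpa [List.getLast?_append] using hlast
    · refine ⟨p :: l, ⟨List.nodup_cons.2 ⟨hp, hnd⟩, ?_, rfl, ?_⟩, ?_⟩
      · rw [List.isChain_cons]
        refine ⟨fun y hy => ?_, hch⟩
        rw [hh] at hy
        obtain rfl : q = y := by simpa using hy
        exact hac.1
      · simp [List.getLast?_cons, hlast]
      · intro x hx
        rcases List.mem_cons.1 hx with rfl | hx
        · exact hac.2.1
        · exact hT x hx

/-- The vertex set `P` of a simple path from `a` to `b` is split by each of its vertices `u` into
the part `P₁` before `u` and the part `P₂` after `u`. -/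
theorem Conn.exists_simple (h : Conn r T a b) (hb : b ∈ T) :
    ∃ P ⊆ T, a ∈ P ∧ b ∈ P ∧ ∀ u ∈ P, ∃ P₁ ⊆ P, ∃ P₂ ⊆ P, Disjoint P₁ P₂ ∧ u ∉ P₁ ∧ u ∉ P₂ ∧
      a ∈ insert u P₁ ∧ b ∈ insert u P₂ ∧
      Conn r (insert u P₁) a u ∧ Conn r (insert u P₂) u b := by
  obtain ⟨l, ⟨hnd, hch, hh, hlast⟩, hT⟩ := exists_isDipath_of_conn h hb
  refine ⟨{x | x ∈ l}, hT, List.mem_of_head? hh, List.mem_of_getLast? hlast, fun u hu => ?_⟩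
  obtain ⟨s, t, rfl⟩ := List.append_of_mem hu
  have hnd' := List.nodup_append.1 hnd
  have hut := List.nodup_cons.1 hnd'.2.1
  have hus : u ∉ s := fun hs => hnd'.2.2 u hs u (by simp) rfl
  have hhead : (s ++ [u]).head? = some a := by
    cases s <;> simpa using hh
  have hlast' : (u :: t).getLast? = some b := by
    simpa [List.getLast?_append] using hlast
  have hch1 : (s ++ [u]).IsChain r := by
    have : s ++ u :: t = (s ++ [u]) ++ t := by simp
    rw [this] at hch
    exact (List.isChain_append.1 hch).1
  have e1 : {x | x ∈ s ++ [u]} = insert u {x | x ∈ s} := by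
    ext x; simp [or_comm]
  have e2 : {x | x ∈ u :: t} = insert u {x | x ∈ t} := by
    ext x; simp
  refine ⟨{x | x ∈ s}, fun x hx => List.mem_append_left _ hx, {x | x ∈ t},
    fun x hx => List.mem_append_right _ (List.mem_cons_of_mem _ hx), ?_, hus, hut.1, ?_, ?_, ?_, ?_⟩
  · rw [Set.disjoint_left]
    exact fun x hx hx' => hnd'.2.2 x hx x (List.mem_cons_of_mem _ hx') rfl
  · rw [← e1]; exact List.mem_of_head? hhead
  · rw [← e2]; exact List.mem_of_getLast? hlast'
  · rw [← e1]; exact conn_of_isChain hch1 hhead (by simp)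
  · rw [← e2]; exact conn_of_isChain (List.isChain_append.1 hch).2.1 rfl hlast'

/-- If `v` and `w` are mutually reachable inside `T`, then there are a cycle through `w` and a path
from `v` that meets this cycle only in its end `u ≠ w`. Here `V` is the path without `u`, and `V₁`
and `V₂` are the interiors of the two segments of the cycle. -/
theorem exists_lollipop {v w : W} (hvw : v ≠ w) (hw : w ∈ T)
    (h₁ : Conn r T v w) (h₂ : Conn r T w v) :
    ∃ u ∈ T, ∃ V ⊆ T, ∃ V₁ ⊆ T, ∃ V₂ ⊆ T, u ≠ w ∧ v ∈ insert u V ∧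
      Disjoint V V₁ ∧ Disjoint V V₂ ∧ Disjoint V₁ V₂ ∧
      u ∉ V ∧ u ∉ V₁ ∧ u ∉ V₂ ∧ w ∉ V ∧ w ∉ V₁ ∧ w ∉ V₂ ∧
      Conn r (insert u V) v u ∧ Conn r (insert u (insert w V₁)) u w ∧
      Conn r (insert u (insert w V₂)) w u := by
  obtain ⟨P, hPT, hvP, hwP, hP⟩ := h₁.exists_simple hw
  obtain ⟨u, ⟨huP, huw⟩, hu⟩ := h₂.first_hit (H := P \ {w}) ⟨hvP, hvw⟩
  have huw' : u ≠ w := huw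
  obtain ⟨P₁, hP₁, P₂, hP₂, hd, hu1, hu2, hv, hw2, c1, c2⟩ := hP u huP
  have hw2' : w ∈ P₂ := by
    rcases hw2 with h | h
    · exact absurd h.symm huw'
    · exact h
  rw [Set.disjoint_left] at hd
  refine ⟨u, hPT huP, P₁, hP₁.trans hPT, P₂ \ {w}, fun x hx => hPT (hP₂ hx.1), T \ P,
    fun x hx => hx.1, huw', hv, ?_, ?_, ?_, hu1, fun h => hu2 h.1, fun h => h.2 huP,
    fun h => hd h hw2', fun h => h.2 rfl, fun h => h.2 hwP, c1, c2.mono ?_, hu.mono ?_⟩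
  · rw [Set.disjoint_left]; exact fun x hx hx' => hd hx hx'.1
  · rw [Set.disjoint_left]; exact fun x hx hx' => hx'.2 (hP₁ hx)
  · rw [Set.disjoint_left]; exact fun x hx hx' => hx'.2 (hP₂ hx.1)
  · intro x hx
    by_cases hxw : x = w
    · simp [hxw]
    · rcases hx with rfl | hx
      · simp
      · exact Or.inr (Or.inr ⟨hx, hxw⟩)
  · rintro x (rfl | ⟨hxT, hx⟩)
    · simp
    · by_cases hxw : x = w
      · simp [hxw]
      · exact Or.inr (Or.inr ⟨hxT, fun h => hx ⟨h, hxw⟩⟩)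

theorem inducesAcyclic_iff {D : Digraph W} : InducesAcyclic D T ↔ Acyc D.Adj T := by
  constructor
  · intro h a b hab hba
    obtain ⟨l, hl, hT⟩ := exists_isDipath_of_conn hba hab.2.1
    exact h l ⟨b, a, hl, hab.1⟩ hT
  · rintro h l ⟨u, v, ⟨-, hch, hh, hlast⟩, hvu⟩ hT
    exact h v u ⟨hvu, hT _ (List.mem_of_getLast? hlast), hT _ (List.mem_of_head? hh)⟩
      ((conn_of_isChain hch hh hlast).mono hT)

end Walks

/-! ### Links and partial cycles -/

/-- The relation `r` if `p` holds, and its reverse otherwise. -/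
def Oriented {W : Type*} (r : W → W → Prop) (p : Prop) (a b : W) : Prop :=
  (p ∧ r a b) ∨ (¬ p ∧ r b a)

/-- A subdivision of the arcs between two consecutive vertices of a cycle, whose branch vertices
are `a` and `b`: there is an arc from the first to the second if `f` holds and one from the second
to the first if `g` holds. The inner vertices lie in `V`. -/
def Link {W : Type*} (r : W → W → Prop) (f g : Prop) (a b : W) (V : Set W) : Prop :=
  ∃ V₁ ⊆ V, ∃ V₂ ⊆ V, Disjoint V₁ V₂ ∧ (f → Conn r (insert a (insert b V₁)) a b) ∧
    (g → Conn r (insert a (insert b V₂)) b a)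

/-- `PartialCycle r x fwd bwd i w U`: there are branch vertices `x = v₀, v₁, …, vᵢ = w` in `U`, and
links inside `U` between consecutive ones, where `fwd j` and `bwd j` tell which of the arcs
`(vⱼ, vⱼ₊₁)` and `(vⱼ₊₁, vⱼ)` the `j`-th link subdivides. -/
def PartialCycle {W : Type*} (r : W → W → Prop) (x : W) (fwd bwd : ℕ → Prop) :
    ℕ → W → Set W → Prop
  | 0, w, U => w = x ∧ x ∈ U
  | i + 1, w, U => ∃ v U₀ V, PartialCycle r x fwd bwd i v U₀ ∧ Link r (fwd i) (bwd i) v w V ∧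
      Disjoint V U₀ ∧ w ∉ U₀ ∧ w ∉ V ∧ w ∈ U ∧ U₀ ⊆ U ∧ V ⊆ U

section Links

variable {W : Type*} {r : W → W → Prop} {x u v w : W} {fwd bwd : ℕ → Prop} {f g p : Prop}
  {i : ℕ} {S T U V V₁ V₂ : Set W}

theorem oriented_of_pos (hp : p) : Oriented r p = r := by
  funext a b; simp [Oriented, hp]

theorem oriented_of_neg (hp : ¬ p) : Oriented r p = Function.swap r := by
  funext a b; simp [Oriented, hp, Function.swap]

theorem acyc_oriented : Acyc (Oriented r p) T ↔ Acyc r T := by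
  by_cases hp : p
  · rw [oriented_of_pos hp]
  · rw [oriented_of_neg hp, acyc_swap]

theorem conn_oriented_of_mutual (h₁ : Conn r T u v) (h₂ : Conn r T v u) :
    Conn (Oriented r p) T u v := by
  by_cases hp : p
  · rwa [oriented_of_pos hp]
  · rwa [oriented_of_neg hp, conn_swap]

theorem link_of_single (hfg : ¬ (f ∧ g))
    (h : Conn (Oriented r f) (insert u (insert v V)) u v) : Link r f g u v V := by
  by_cases hf : f
  · rw [oriented_of_pos hf] at h
    exact ⟨V, subset_rfl, ∅, Set.empty_subset _, by simp, fun _ => h,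
      fun hg => absurd ⟨hf, hg⟩ hfg⟩
  · rw [oriented_of_neg hf, conn_swap] at h
    exact ⟨∅, Set.empty_subset _, V, subset_rfl, by simp, fun hf' => absurd hf' hf, fun _ => h⟩

theorem Link.conn_oriented (h : Link r f g u v V) (hfg : f ∨ g) :
    Conn (Oriented r f) (insert u (insert v V)) u v := by
  obtain ⟨V₁, h₁, V₂, h₂, -, hf, hg⟩ := h
  by_cases hf' : f
  · rw [oriented_of_pos hf']
    exact (hf hf').mono (Set.insert_subset_insert (Set.insert_subset_insert h₁))
  · rw [oriented_of_neg hf', conn_swap]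
    exact (hg (hfg.resolve_left hf')).mono (Set.insert_subset_insert (Set.insert_subset_insert h₂))

theorem link_of_cycle (hd : Disjoint V₁ V₂)
    (h₁ : Conn (Oriented r p) (insert u (insert v V₁)) u v)
    (h₂ : Conn (Oriented r p) (insert u (insert v V₂)) v u) : Link r f g u v (V₁ ∪ V₂) := by
  by_cases hp : p
  · rw [oriented_of_pos hp] at h₁ h₂
    exact ⟨V₁, Set.subset_union_left, V₂, Set.subset_union_right, hd, fun _ => h₁, fun _ => h₂⟩
  · rw [oriented_of_neg hp, conn_swap] at h₁ h₂
    exact ⟨V₂, Set.subset_union_right, V₁, Set.subset_union_left, hd.symm, fun _ => h₂, fun _ => h₁⟩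

theorem PartialCycle.mono (h : PartialCycle r x fwd bwd i w U) (hU : U ⊆ T) :
    PartialCycle r x fwd bwd i w T := by
  cases i with
  | zero => exact ⟨h.1, hU h.2⟩
  | succ i =>
    obtain ⟨v, U₀, V, h1, h2, h3, h4, h5, h6, h7, h8⟩ := h
    exact ⟨v, U₀, V, h1, h2, h3, h4, h5, hU h6, h7.trans hU, h8.trans hU⟩

/-- If the last link of a partial cycle subdivides a single arc, then the link can be extended by a
path in the direction of that arc. -/
theorem PartialCycle.extend (h : PartialCycle r x fwd bwd (i + 1) v U)
    (h₁ : ¬ (fwd i ∧ bwd i)) (h₂ : fwd i ∨ bwd i)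
    (hc : Conn (Oriented r (fwd i)) (insert u V) v u) (hv : v ∈ insert u V)
    (hVU : ∀ y ∈ insert u V, y ∈ U → y = v) (hu : u ∉ V) :
    PartialCycle r x fwd bwd (i + 1) u (insert u (U ∪ V)) := by
  rcases eq_or_ne v u with rfl | hvu
  · exact h.mono fun y hy => Or.inr (Or.inl hy)
  have hvV : v ∈ V := hv.resolve_left hvu
  have huU : u ∉ U := fun h => hvu (hVU u (Or.inl rfl) h).symm
  obtain ⟨a, U₀, V₀, ha, hl, hd, hv0, hvV0, hvU, hU0, hV0⟩ := h
  refine ⟨a, U₀, V₀ ∪ V, ha, link_of_single h₁ ?_, ?_, fun h => huU (hU0 h), ?_, Or.inl rfl,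
    fun y hy => Or.inr (Or.inl (hU0 hy)), ?_⟩
  · refine ((hl.conn_oriented h₂).mono ?_).trans (hc.mono ?_)
    · rintro y (rfl | rfl | hy)
      · simp
      · simp [hvV]
      · simp [hy]
    · rintro y (rfl | hy)
      · simp
      · simp [hy]
  · rw [Set.disjoint_left] at hd ⊢
    rintro y (hy | hy) hy0
    · exact hd hy hy0
    · exact hv0 (hVU y (Or.inr hy) (hU0 hy0) ▸ hy0)
  · rintro (h | h)
    · exact huU (hV0 h)
    · exact hu h
  · rintro y (hy | hy)
    · exact Or.inr (Or.inl (hV0 hy))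
    · exact Or.inr (Or.inr hy)

/-- The branch vertices and the inner vertex sets of the links of a partial cycle. The set
`Z j true` belongs to the arc `(vⱼ, vⱼ₊₁)` and `Z j false` to the arc `(vⱼ₊₁, vⱼ)`. -/
theorem PartialCycle.exists_sequence (h : PartialCycle r x fwd bwd i w U) :
    ∃ (f : ℕ → W) (Z : ℕ → Bool → Set W), f 0 = x ∧ f i = w ∧ (∀ j ≤ i, f j ∈ U) ∧
      (∀ j < i, ∀ d, Z j d ⊆ U) ∧ (∀ j ≤ i, ∀ j' ≤ i, f j = f j' → j = j') ∧
      (∀ j ≤ i, ∀ j' < i, ∀ d, f j ∉ Z j' d) ∧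
      (∀ j < i, ∀ d, ∀ j' < i, ∀ d', ∀ y, y ∈ Z j d → y ∈ Z j' d' → j = j' ∧ d = d') ∧
      (∀ j < i, fwd j → Conn r (insert (f j) (insert (f (j + 1)) (Z j true))) (f j) (f (j + 1))) ∧
      (∀ j < i, bwd j →
        Conn r (insert (f j) (insert (f (j + 1)) (Z j false))) (f (j + 1)) (f j)) := by
  induction i generalizing w U with
  | zero =>
    obtain ⟨rfl, hU⟩ := h
    refine ⟨fun _ => w, fun _ _ => ∅, rfl, rfl, fun _ _ => hU, by simp, fun j hj j' hj' _ => ?_,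
      by simp, by simp, by simp, by simp⟩
    omega
  | succ i ih =>
    obtain ⟨v, U₀, V, hpc, ⟨V₁, hV₁, V₂, hV₂, hV, hf, hg⟩, hd, hw0, hwV, hwU, hU0, hVU⟩ := h
    obtain ⟨f, Z, h0, hi, hfU, hZU, hinj, hfZ, hZ, hfw, hbw⟩ := ih hpc
    rw [Set.disjoint_left] at hd hV
    have hVd : ∀ d : Bool, (if d then V₁ else V₂) ⊆ V := by
      intro d; cases d <;> simpa
    refine ⟨fun j => if j ≤ i then f j else w,
      fun j d => if j < i then Z j d else if d then V₁ else V₂, by simpa using h0, by simp,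
      ?_, ?_, ?_, ?_, ?_, ?_, ?_⟩
    · intro j _
      by_cases hj : j ≤ i
      · simpa [hj] using hU0 (hfU j hj)
      · simpa [hj] using hwU
    · intro j _ d
      by_cases hj : j < i
      · simpa [hj] using (hZU j hj d).trans hU0
      · simpa [hj] using (hVd d).trans hVU
    · intro j hj j' hj' he
      by_cases h1 : j ≤ i <;> by_cases h2 : j' ≤ i <;> simp only [h1, h2, if_true, if_false] at he
      · exact hinj j h1 j' h2 he
      · exact absurd (he ▸ hfU j h1) hw0
      · exact absurd (he ▸ hfU j' h2) hw0
      · omega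
    · intro j hj j' hj' d
      by_cases h1 : j ≤ i <;> by_cases h2 : j' < i <;> simp only [h1, h2, if_true, if_false]
      · exact hfZ j h1 j' h2 d
      · exact fun h => hd (hVd d h) (hfU j h1)
      · exact fun h => hw0 (hZU j' h2 d h)
      · exact fun h => hwV (hVd d h)
    · intro j hj d j' hj' d' y hy hy'
      by_cases h1 : j < i <;> by_cases h2 : j' < i <;>
        simp only [h1, h2, if_true, if_false] at hy hy'
      · exact hZ j h1 d j' h2 d' y hy hy'
      · exact absurd (hZU j h1 d hy) (hd (hVd d' hy'))
      · exact absurd (hZU j' h2 d' hy') (hd (hVd d hy))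
      · refine ⟨by omega, ?_⟩
        cases d <;> cases d' <;> simp only [if_true, Bool.false_eq_true, if_false] at hy hy'
        · rfl
        · exact absurd hy (hV hy')
        · exact absurd hy' (hV hy)
        · rfl
    · intro j hj hj'
      rcases Nat.lt_succ_iff_lt_or_eq.1 hj with h1 | rfl
      · have h2 : j + 1 ≤ i := h1
        simpa [h1, h1.le, h2] using hfw j h1 hj'
      · simpa [hi] using hf hj'
    · intro j hj hj'
      rcases Nat.lt_succ_iff_lt_or_eq.1 hj with h1 | rfl
      · have h2 : j + 1 ≤ i := h1
        simpa [h1, h1.le, h2] using hbw j h1 hj'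
      · simpa [hi] using hg hj'

end Links

/-! ### Seeds and their spreads -/

open Classical in
/-- The vertices of the colour class `X i` to which the `i`-th vertex of a partial cycle can be
moved from `s`: along arcs of `X i` in the direction of the `i`-th link if that link is a single
arc, and inside a strong component of `X i ∪ X (i + 1)` if it is a digon. -/
def spread {W : Type*} (r : W → W → Prop) (fwd bwd : ℕ → Prop) (X : ℕ → Set W) (i : ℕ)
    (s : Set W) : Set W :=
  {w | w ∈ X i ∧ ∃ v ∈ s, if fwd i ∧ bwd i then
    Conn r (X i ∪ X (i + 1)) v w ∧ Conn r (X i ∪ X (i + 1)) w v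
    else Conn (Oriented r (fwd i)) (X i) v w}

open Classical in
/-- The set `seed i` consists of the vertices of colour `i` at which a partial cycle with `i` links
whose vertices have increasing colours is guaranteed to end. -/
def seed {W : Type*} (r : W → W → Prop) (fwd bwd : ℕ → Prop) (X : ℕ → Set W) : ℕ → Set W
  | 0 => X 0
  | i + 1 => {w | w ∈ X (i + 1) ∧ ∃ v ∈ seed r fwd bwd X i, if fwd i ∧ bwd i then
      Conn r (X i ∪ X (i + 1)) v w ∧ Conn r (X i ∪ X (i + 1)) w v
      else ∃ a ∈ X i, Conn (Oriented r (fwd i)) (X i) v a ∧ Oriented r (fwd i) a w}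

/-- The vertices of all spread seeds of colours less than `i`. -/
def lower {W : Type*} (r : W → W → Prop) (fwd bwd : ℕ → Prop) (X : ℕ → Set W) (i : ℕ) : Set W :=
  {w | ∃ j < i, w ∈ spread r fwd bwd X j (seed r fwd bwd X j)}

section Seeds

variable {W : Type*} {r : W → W → Prop} {fwd bwd : ℕ → Prop} {X : ℕ → Set W} {i k : ℕ} {x w : W}

theorem seed_subset : seed r fwd bwd X i ⊆ X i := by
  cases i with
  | zero => exact subset_rfl
  | succ i => exact fun w hw => hw.1

theorem seed_subset_spread :
    seed r fwd bwd X i ⊆ spread r fwd bwd X i (seed r fwd bwd X i) := by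
  intro w hw
  refine ⟨seed_subset hw, w, hw, ?_⟩
  split_ifs
  · exact ⟨ReflTransGen.refl, ReflTransGen.refl⟩
  · exact ReflTransGen.refl

theorem lower_succ : lower r fwd bwd X (i + 1) =
    lower r fwd bwd X i ∪ spread r fwd bwd X i (seed r fwd bwd X i) := by
  ext w
  simp only [lower, Set.mem_ofPred_eq, Set.mem_union, Nat.lt_succ_iff_lt_or_eq]
  constructor
  · rintro ⟨j, hj | rfl, h⟩
    · exact Or.inl ⟨j, hj, h⟩
    · exact Or.inr h
  · rintro (⟨j, hj, h⟩ | h)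
    · exact ⟨j, Or.inl hj, h⟩
    · exact ⟨i, Or.inr rfl, h⟩

/-- Every vertex of `seed i` ends a partial cycle with `i` links whose vertices lie in the spread
seeds of smaller colours and in `seed i`. If the last link is not a digon, then the end is the only
vertex of the partial cycle in `seed i`. -/
theorem exists_partialCycle (hX : ∀ i j, ∀ w ∈ X i, w ∈ X j → i = j) (hx : X 0 = {x})
    (hX1 : Acyc r (X 1)) (hor : ∀ i < k, fwd i ∨ bwd i)
    (hcons : ∀ i, i + 1 < k → fwd i ∧ bwd i → ¬ (fwd (i + 1) ∧ bwd (i + 1)))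
    (hi : i ≤ k) (hw : w ∈ seed r fwd bwd X i) :
    ∃ U, PartialCycle r x fwd bwd i w U ∧ U ⊆ lower r fwd bwd X i ∪ seed r fwd bwd X i ∧
      ((∀ j, i = j + 1 → ¬ (fwd j ∧ bwd j)) → U ⊆ insert w (lower r fwd bwd X i)) := by
  induction i generalizing w with
  | zero =>
    have hwx : w ∈ X 0 := hw
    rw [hx] at hwx
    refine ⟨{w}, ⟨hwx, hwx.symm⟩, ?_, ?_⟩
    · rintro y rfl; exact Or.inr hw
    · rintro - y rfl; exact Or.inl rfl
  | succ i ih =>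
    have hlow : ∀ y ∈ lower r fwd bwd X i, y ∉ X i ∧ y ∉ X (i + 1) := by
      rintro y ⟨j, hj, hy⟩
      exact ⟨fun h => hj.ne (hX _ _ y hy.1 h), fun h => (by omega : j ≠ i + 1) (hX _ _ y hy.1 h)⟩
    have hwX := seed_subset hw
    have hwXi : w ∉ X i := fun h => by have := hX _ _ w h hwX; omega
    by_cases hdi : fwd i ∧ bwd i
    · obtain ⟨-, v, hv, hvw⟩ := id hw
      rw [if_pos hdi] at hvw
      have hvX := seed_subset hv
      have hvwne : v ≠ w := fun h => hwXi (h ▸ hvX)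
      set T : Set W := spread r fwd bwd X i (seed r fwd bwd X i) ∪ seed r fwd bwd X (i + 1)
        with hT
      have hTX : T ⊆ X i ∪ X (i + 1) := by
        rintro y (hy | hy)
        · exact Or.inl hy.1
        · exact Or.inr (seed_subset hy)
      have key : ∀ y, Conn r (X i ∪ X (i + 1)) v y → Conn r (X i ∪ X (i + 1)) y v → y ∈ T := by
        intro y h1 h2
        rcases h1.mem (Or.inl hvX) with hy | hy
        · exact Or.inl ⟨hy, v, hv, by rw [if_pos hdi]; exact ⟨h1, h2⟩⟩
        · exact Or.inr ⟨hy, v, hv, by rw [if_pos hdi]; exact ⟨h1, h2⟩⟩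
      have c1 : Conn r T v w := hvw.1.restrict fun y h1 h2 => key y h1 (h2.trans hvw.2)
      have c2 : Conn r T w v := hvw.2.restrict fun y h1 h2 => key y (hvw.1.trans h1) h2
      have hprev : ∀ j, i = j + 1 → ¬ (fwd j ∧ bwd j) := by
        rintro j rfl hj
        exact hcons j (by omega) hj hdi
      obtain ⟨U, hU, -, hUv⟩ := ih (by omega) hv
      have hUv := hUv hprev
      -- The link before the digon determines the direction in which the strong component is
      -- traversed, so that its path to the cycle through `w` prolongs that link.
      obtain ⟨u, huT, V, hVT, V₁, hV₁, V₂, hV₂, huw, hvV, hd1, hd2, hd12, huV, hu1, hu2, hwV, hw1,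
        hw2, p, q1, q2⟩ := exists_lollipop hvwne (Or.inr hw)
          (conn_oriented_of_mutual (p := fwd (i - 1)) c1 c2)
          (conn_oriented_of_mutual (p := fwd (i - 1)) c2 c1)
      rw [Set.disjoint_left] at hd1 hd2
      have hTlow : ∀ y ∈ T, y ∉ lower r fwd bwd X i := by
        intro y hy hy'
        rcases hTX hy with h | h
        · exact (hlow y hy').1 h
        · exact (hlow y hy').2 h
      have hTU : ∀ y ∈ T, y ∈ U → y = v := by
        intro y hy hyU
        exact (hUv hyU).resolve_right (hTlow y hy)
      have hpc : PartialCycle r x fwd bwd i u (insert u (U ∪ V)) := by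
        cases i with
        | zero =>
          have hvx : v ∈ X 0 := hvX
          rw [hx] at hvx
          obtain rfl : v = x := hvx
          suffices u = v by
            subst this
            exact ⟨rfl, Or.inl rfl⟩
          by_contra huv
          have hvV' : v ∈ V := hvV.resolve_left fun h => huv h.symm
          have aux : ∀ y ∈ T, y ≠ v → y ∈ X 1 := by
            intro y hy hyv
            rcases hTX hy with h | h
            · rw [hx] at h; exact absurd h hyv
            · exact h
          have sub : ∀ V' ⊆ T, (v ∉ V') → insert u (insert w V') ⊆ X 1 := by
            rintro V' hV' hv' y (rfl | rfl | hy)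
            · exact aux _ huT huv
            · exact hwX
            · exact aux _ (hV' hy) fun h => hv' (h ▸ hy)
          exact huw ((acyc_oriented.2 hX1).eq_of_conn (q1.mono (sub V₁ hV₁ (hd1 hvV')))
            (q2.mono (sub V₂ hV₂ (hd2 hvV'))))
        | succ j =>
          refine hU.extend (hprev j rfl) (hor j (by omega)) p hvV ?_ huV
          rintro y (rfl | hy) hyU
          · exact hTU _ huT hyU
          · exact hTU _ (hVT hy) hyU
      have hvV₁ : v ∉ V₁ := by
        rcases hvV with rfl | h
        · exact hu1
        · exact hd1 h
      have hvV₂ : v ∉ V₂ := by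
        rcases hvV with rfl | h
        · exact hu2
        · exact hd2 h
      have hsub : T ⊆ lower r fwd bwd X (i + 1) ∪ seed r fwd bwd X (i + 1) := by
        rw [lower_succ]
        rintro y (hy | hy)
        · exact Or.inl (Or.inr hy)
        · exact Or.inr hy
      refine ⟨insert w (insert u (U ∪ V) ∪ (V₁ ∪ V₂)),
        ⟨u, insert u (U ∪ V), V₁ ∪ V₂, hpc, link_of_cycle hd12 q1 q2, ?_, ?_, ?_, Or.inl rfl,
          fun y hy => Or.inr (Or.inl hy), fun y hy => Or.inr (Or.inr hy)⟩, ?_, ?_⟩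
      · rw [Set.disjoint_left]
        rintro y (hy | hy) (rfl | hy' | hy')
        · exact hu1 hy
        · exact hvV₁ (hTU y (hV₁ hy) hy' ▸ hy)
        · exact hd1 hy' hy
        · exact hu2 hy
        · exact hvV₂ (hTU y (hV₂ hy) hy' ▸ hy)
        · exact hd2 hy' hy
      · rintro (h | h | h)
        · exact huw h.symm
        · exact hvwne (hTU w (Or.inr hw) h).symm
        · exact hwV h
      · rintro (h | h)
        · exact hw1 h
        · exact hw2 h
      · rintro y (rfl | (rfl | hy | hy) | hy | hy)
        · exact Or.inr hw
        · exact hsub huT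
        · rcases hUv hy with rfl | h
          · exact hsub (Or.inl (seed_subset_spread hv))
          · rw [lower_succ]; exact Or.inl (Or.inl h)
        · exact hsub (hVT hy)
        · exact hsub (hV₁ hy)
        · exact hsub (hV₂ hy)
      · exact fun h => absurd hdi (h i rfl)
    · obtain ⟨-, s, hs, hsw⟩ := id hw
      rw [if_neg hdi] at hsw
      obtain ⟨a, haX, hsa, haw⟩ := hsw
      set A : Set W := spread r fwd bwd X i (seed r fwd bwd X i) with hA
      have hAX : A ⊆ X i := fun y hy => hy.1
      have key : ∀ y, Conn (Oriented r (fwd i)) (X i) s y → y ∈ A := fun y hy =>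
        ⟨hy.mem (seed_subset hs), s, hs, by rwa [if_neg hdi]⟩
      have c1 : Conn (Oriented r (fwd i)) (insert w A) s w :=
        Conn.trans (hsa.restrict fun y h1 _ => Or.inr (key y h1))
          (Conn.single haw (Or.inr (key a hsa)) (Or.inl rfl))
      obtain ⟨u, hu, hc⟩ := c1.last_exit hs
      obtain ⟨U, hU, hU', -⟩ := ih (by omega) hu
      have hwU : w ∉ U := by
        intro h
        rcases hU' h with h | h
        · exact (hlow w h).2 hwX
        · exact hwXi (seed_subset h)
      have hsub : insert w (U ∪ A \ seed r fwd bwd X i) ⊆ insert w (lower r fwd bwd X (i + 1)) := by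
        rw [lower_succ]
        rintro y (rfl | hy | hy)
        · exact Or.inl rfl
        · rcases hU' hy with h | h
          · exact Or.inr (Or.inl h)
          · exact Or.inr (Or.inr (seed_subset_spread h))
        · exact Or.inr (Or.inr hy.1)
      refine ⟨insert w (U ∪ A \ seed r fwd bwd X i), ⟨u, U, A \ seed r fwd bwd X i, hU,
        link_of_single hdi (hc.mono ?_), ?_, hwU, fun h => hwXi (hAX h.1), Or.inl rfl,
        fun y hy => Or.inr (Or.inl hy), fun y hy => Or.inr (Or.inr hy)⟩, ?_, fun _ => hsub⟩
      · rintro y (rfl | ⟨rfl | hy, hy'⟩)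
        · exact Or.inl rfl
        · exact Or.inr (Or.inl rfl)
        · exact Or.inr (Or.inr ⟨hy, hy'⟩)
      · rw [Set.disjoint_left]
        rintro y ⟨hy, hys⟩ hyU
        rcases hU' hyU with h | h
        · exact (hlow y h).1 (hAX hy)
        · exact hys h
      · refine hsub.trans ?_
        rintro y (rfl | hy)
        · exact Or.inr hw
        · exact Or.inl hy

end Seeds

/-! ### Recolouring -/

/-- The vertices of `S` can be coloured with `1, …, k` so that every colour class is acyclic. -/
def Colorable {W : Type*} (r : W → W → Prop) (S : Set W) (k : ℕ) : Prop :=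
  ∃ c : W → ℕ, (∀ w ∈ S, 1 ≤ c w ∧ c w ≤ k) ∧ ∀ i, Acyc r {w ∈ S | c w = i}

section Recolouring

variable {W : Type*} {r : W → W → Prop} {fwd bwd : ℕ → Prop} {k : ℕ} {x : W}

/-- If `T` is coloured with `0, …, k`, where `x` is the only vertex of colour `0`, and `T` has no
colouring with `1, …, k`, then some vertex of `seed k` can be joined to `x`, in the direction of the
`k`-th link, by a path avoiding the spread seeds of smaller colours. Otherwise the colours of these
spread seeds and of the set `B` of vertices that can be reached from `seed k` outside of them could
be shifted cyclically. -/
theorem exists_closing_walk {T : Set W} {c : W → ℕ} (hr : ∀ v, ¬ r v v) (hk : 1 ≤ k)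
    (hxT : x ∈ T) (hcx : ∀ w ∈ T, c w = 0 ↔ w = x) (hck : ∀ w ∈ T, c w ≤ k)
    (hc : ∀ i, Acyc r {w ∈ T | c w = i}) (h0 : fwd 0 ∧ bwd 0) (hT : ¬ Colorable r T k) :
    ∃ s ∈ seed r fwd bwd (fun i => {w ∈ T | c w = i}) k,
      Conn (Oriented r (fwd k))
        (insert x (T \ lower r fwd bwd (fun i => {w ∈ T | c w = i}) k)) s x := by
  classical
  by_contra! hno
  set X : ℕ → Set W := fun i => {w ∈ T | c w = i} with hX
  set L : Set W := lower r fwd bwd X k with hL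
  have hLc : ∀ w ∈ L, w ∈ T ∧ c w < k ∧ w ∈ spread r fwd bwd X (c w) (seed r fwd bwd X (c w)) := by
    rintro w ⟨j, hj, hw⟩
    obtain ⟨hwT, rfl⟩ := hw.1
    exact ⟨hwT, hj, hw⟩
  have hX0 : X 0 = {x} := by
    ext w
    constructor
    · rintro ⟨hw, h⟩; exact (hcx w hw).1 h
    · rintro rfl; exact ⟨hxT, (hcx w hxT).2 rfl⟩
  have hxs : x ∈ seed r fwd bwd X 0 := by
    change x ∈ X 0
    rw [hX0]; rfl
  have hxL : x ∈ L := ⟨0, hk, seed_subset_spread hxs⟩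
  set B : Set W := {w | w ∈ T \ L ∧ ∃ s ∈ seed r fwd bwd X k,
    Conn (Oriented r (fwd k)) (T \ L) s w} with hB
  have hBclosed : ∀ u ∈ B, ∀ w ∈ T \ L, Oriented r (fwd k) u w → w ∈ B := by
    rintro u ⟨hu, s, hs, hsu⟩ w hw huw
    exact ⟨hw, s, hs, Conn.trans hsu (Conn.single huw hu hw)⟩
  have hseed : ∀ i, i + 1 ≤ k → ∀ w ∈ seed r fwd bwd X (i + 1), w ∈ L ∨ w ∈ B := by
    intro i hi w hw
    rcases hi.lt_or_eq with h | h
    · exact Or.inl ⟨i + 1, h, seed_subset_spread hw⟩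
    · have hwX : w ∈ T ∧ c w = i + 1 := seed_subset hw
      have hwL : w ∉ L := fun h' => by
        have h1 := (hLc w h').2.1
        have h2 := hwX.2
        omega
      subst h
      exact Or.inr ⟨⟨hwX.1, hwL⟩, w, hw, ReflTransGen.refl⟩
  have hBO : ∀ i j, Acyc r {w | (w ∈ B ∧ c w = i) ∨ (w ∈ T ∧ c w = j ∧ w ∉ L ∧ w ∉ B)} := by
    intro i j
    have hsub : {w | w ∈ B ∧ c w = i} ⊆ {w ∈ T | c w = i} := fun w hw => ⟨hw.1.1.1, hw.2⟩
    rw [← acyc_oriented (p := fwd k)]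
    refine acyc_of_no_arc (A := {w | w ∈ B ∧ c w = i})
      (acyc_oriented.2 ((hc i).mono hsub))
      (acyc_oriented.2 ((hc j).mono ?_)) ?_
    · rintro w ⟨hw | hw, hw'⟩
      · exact absurd hw hw'
      · exact ⟨hw.1, hw.2.1⟩
    · rintro u hu w (hw | hw) huw
      · exact hw
      · exact absurd (hBclosed u hu.1 w ⟨hw.1, hw.2.2.1⟩ huw) hw.2.2.2
  refine hT ⟨fun w => if w ∈ L then c w + 1 else if w ∈ B then (if c w = k then 1 else c w + 1)
    else c w, ?_, ?_⟩
  · intro w hw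
    have h1 := hck w hw
    dsimp only
    split_ifs with h2 h3 h4
    · have := (hLc w h2).2.1; omega
    · omega
    · omega
    · refine ⟨?_, h1⟩
      by_contra h5
      have : w = x := (hcx w hw).1 (by omega)
      exact h2 (this ▸ hxL)
  intro n
  have hcls : ∀ w, w ∈ T → (if w ∈ L then c w + 1 else if w ∈ B then
      (if c w = k then 1 else c w + 1) else c w) = n →
      (w ∈ L ∧ c w + 1 = n) ∨ (w ∈ B ∧ w ∉ L ∧ c w = k ∧ n = 1) ∨
      (w ∈ B ∧ w ∉ L ∧ c w ≠ k ∧ c w + 1 = n) ∨ (w ∉ L ∧ w ∉ B ∧ c w = n) := by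
    intro w _ h
    split_ifs at h with h2 h3 h4
    · exact Or.inl ⟨h2, h⟩
    · exact Or.inr (Or.inl ⟨h3, h2, h4, h.symm⟩)
    · exact Or.inr (Or.inr (Or.inl ⟨h3, h2, h4, h⟩))
    · exact Or.inr (Or.inr (Or.inr ⟨h2, h3, h⟩))
  have hne0 : ∀ w ∈ T, w ∉ L → c w ≠ 0 := fun w hw hwL h => hwL ((hcx w hw).1 h ▸ hxL)
  rcases n with _ | _ | i
  · -- No vertex gets colour `0`.
    intro a _ ⟨_, ⟨haT, ha⟩, _⟩
    rcases hcls a haT ha with h | h | h | h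
    · omega
    · omega
    · omega
    · exact absurd h.2.2 (hne0 a haT h.1)
  · -- Colour `1`: a closed walk through `x` either avoids `B`, and then lies in `seed 1`, or it
    -- yields a closing walk.
    set Y : Set W := {w ∈ T | (if w ∈ L then c w + 1 else if w ∈ B then
      (if c w = k then 1 else c w + 1) else c w) = 0 + 1} with hY
    have hYc : ∀ w ∈ Y, w = x ∨ (w ∉ L ∧ w ∈ B ∧ c w = k) ∨ (w ∉ L ∧ w ∉ B ∧ c w = 1) := by
      intro w hw
      rcases hcls w hw.1 hw.2 with h | h | h | h
      · exact Or.inl ((hcx w hw.1).1 (by omega))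
      · exact Or.inr (Or.inl ⟨h.2.1, h.1, h.2.2.1⟩)
      · exact absurd (by omega) (hne0 w hw.1 h.2.1)
      · exact Or.inr (Or.inr ⟨h.1, h.2.1, h.2.2⟩)
    refine acyc_of_absorb (A := {x}) (acyc_of_subsingleton hr Set.subsingleton_singleton)
      ((hBO k 1).mono ?_) ?_
    · rintro w ⟨hw, hwx⟩
      rcases hYc w hw with h | h | h
      · exact absurd h hwx
      · exact Or.inl ⟨h.2.1, h.2.2⟩
      · exact Or.inr ⟨hw.1, h.2.2, h.1, h.2.1⟩
    · intro u hu w hw h1 h2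
      have hux : u = x := hu
      rw [hux] at h1 h2
      by_contra hwx
      by_cases hb : ∃ b ∈ B, Conn r Y x b ∧ Conn r Y b x
      · obtain ⟨b, ⟨-, s, hs, hsb⟩, hxb, hbx⟩ := hb
        refine hno s hs ((hsb.mono (Set.subset_insert _ _)).trans
          ((conn_oriented_of_mutual hbx hxb).mono fun y hy => ?_))
        rcases hYc y hy with h | h | h
        · exact Or.inl h
        · exact Or.inr ⟨hy.1, h.1⟩
        · exact Or.inr ⟨hy.1, h.1⟩
      · push Not at hb
        have hxY : x ∈ Y := h2.mem hw
        have hY01 : ∀ y, Conn r Y x y → Conn r Y y x → y ∈ X 0 ∪ X (0 + 1) := by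
          intro y hy hy'
          rcases hYc y (hy.mem hxY) with h | h | h
          · rw [hX0]; exact Or.inl h
          · exact absurd hy' (hb y h.2.1 hy)
          · exact Or.inr ⟨(hy.mem hxY).1, h.2.2⟩
        have hwX := hY01 w h1 h2
        rw [hX0] at hwX
        have hws : w ∈ seed r fwd bwd X (0 + 1) := by
          refine ⟨hwX.resolve_left hwx, x, hxs, ?_⟩
          rw [if_pos h0]
          exact ⟨h1.restrict fun y hy hy' => hY01 y hy (hy'.trans h2),
            h2.restrict fun y hy hy' => hY01 y (h1.trans hy) hy'⟩
        have hwB : w ∉ B := fun h => hb w h h1 h2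
        rcases hYc w hw with h | h | h
        · exact hwx h
        · exact hwB h.2.1
        · exact (hseed 0 hk w hws).elim h.1 hwB
  · -- Colour `i + 2`: the shifted vertices of colour `i + 1` and the remaining ones of colour `i + 2`.
    set Y : Set W := {w ∈ T | (if w ∈ L then c w + 1 else if w ∈ B then
      (if c w = k then 1 else c w + 1) else c w) = i + 1 + 1} with hY
    have hYc : ∀ w ∈ Y, (w ∈ L ∧ c w = i + 1) ∨ (w ∉ L ∧ w ∈ B ∧ c w = i + 1) ∨
        (w ∉ L ∧ w ∉ B ∧ c w = i + 2) := by
      intro w hw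
      rcases hcls w hw.1 hw.2 with h | h | h | h
      · exact Or.inl ⟨h.1, by omega⟩
      · omega
      · exact Or.inr (Or.inl ⟨h.2.1, h.1, by omega⟩)
      · exact Or.inr (Or.inr ⟨h.1, h.2.1, h.2.2⟩)
    set A : Set W := spread r fwd bwd X (i + 1) (seed r fwd bwd X (i + 1)) with hA
    have hLA : ∀ w ∈ L, c w = i + 1 → w ∈ A := by
      intro w hw hcw
      have := (hLc w hw).2.2
      rwa [hcw] at this
    have hAX : A ⊆ X (i + 1) := fun w hw => hw.1
    have hAacyc : Acyc r A := (hc (i + 1)).mono hAX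
    have hrest : Acyc r (Y \ A) := by
      refine (hBO (i + 1) (i + 2)).mono ?_
      rintro w ⟨hw, hwA⟩
      rcases hYc w hw with h | h | h
      · exact absurd (hLA w h.1 h.2) hwA
      · exact Or.inl h.2
      · exact Or.inr ⟨hw.1, h.2.2, h.1, h.2.1⟩
    have hYX : Y ⊆ X (i + 1) ∪ X (i + 1 + 1) := by
      intro w hw
      rcases hYc w hw with h | h | h
      · exact Or.inl ⟨hw.1, h.2⟩
      · exact Or.inl ⟨hw.1, h.2.2⟩
      · exact Or.inr ⟨hw.1, h.2.2⟩
    have hnot : ∀ w ∈ Y, c w = i + 2 → w ∉ seed r fwd bwd X (i + 1 + 1) := by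
      intro w hw hcw hws
      rcases hYc w hw with h | h | h
      · omega
      · omega
      · exact (hseed (i + 1) (by have := hck w hw.1; omega) w hws).elim h.1 h.2.1
    by_cases hd : fwd (i + 1) ∧ bwd (i + 1)
    · refine acyc_of_absorb hAacyc hrest fun u hu w hw h1 h2 => ?_
      obtain ⟨-, s, hs, hsu⟩ := hu
      rw [if_pos hd] at hsu
      have hsw : Conn r (X (i + 1) ∪ X (i + 1 + 1)) s w ∧
          Conn r (X (i + 1) ∪ X (i + 1 + 1)) w s :=
        ⟨hsu.1.trans (h1.mono hYX), (h2.mono hYX).trans hsu.2⟩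
      rcases hYX hw with h | h
      · exact ⟨h, s, hs, by rwa [if_pos hd]⟩
      · exact absurd ⟨h, s, hs, by rwa [if_pos hd]⟩ (hnot w hw h.2)
    · rw [← acyc_oriented (p := fwd (i + 1))] at hAacyc hrest ⊢
      refine acyc_of_no_arc hAacyc hrest fun u hu w hw huw => ?_
      obtain ⟨huX, s, hs, hsu⟩ := hu
      rw [if_neg hd] at hsu
      rcases hYX hw with h | h
      · refine ⟨h, s, hs, ?_⟩
        rw [if_neg hd]
        exact Conn.trans hsu (Conn.single huw huX h)
      · refine absurd ⟨h, s, hs, ?_⟩ (hnot w hw h.2)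
        rw [if_neg hd]
        exact ⟨u, huX, hsu, huw⟩

/-- If `S` has an acyclic colouring with `k` colours and `S ∪ {x}` has none, then `S ∪ {x}` contains
a subdivision of every oriented cycle of length `k + 1` with suitable digons, such that `x` is its
first branch vertex. The branch vertices are `f 0, …, f k` and `f (k + 1) = x = f 0`. -/
theorem exists_cycle {S : Set W} (hr : ∀ v, ¬ r v v) (hk : 1 ≤ k) (hx : x ∉ S)
    (h0 : fwd 0 ∧ bwd 0) (hor : ∀ i ≤ k, fwd i ∨ bwd i) (hlast : ¬ (fwd k ∧ bwd k))
    (hcons : ∀ i, i + 1 < k → fwd i ∧ bwd i → ¬ (fwd (i + 1) ∧ bwd (i + 1)))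
    (hS : Colorable r S k) (hSx : ¬ Colorable r (insert x S) k) :
    ∃ (f : ℕ → W) (Z : ℕ → Bool → Set W), f 0 = x ∧ f (k + 1) = x ∧
      (∀ j ≤ k, f j ∈ insert x S) ∧ (∀ j ≤ k, ∀ d, Z j d ⊆ S) ∧
      (∀ j ≤ k, ∀ j' ≤ k, f j = f j' → j = j') ∧
      (∀ j ≤ k, ∀ j' ≤ k, ∀ d, f j ∉ Z j' d) ∧
      (∀ j ≤ k, ∀ d, ∀ j' ≤ k, ∀ d', ∀ y, y ∈ Z j d → y ∈ Z j' d' → j = j' ∧ d = d') ∧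
      (∀ j ≤ k, fwd j → Conn r (insert (f j) (insert (f (j + 1)) (Z j true))) (f j) (f (j + 1))) ∧
      (∀ j ≤ k, bwd j →
        Conn r (insert (f j) (insert (f (j + 1)) (Z j false))) (f (j + 1)) (f j)) := by
  classical
  obtain ⟨c, hc, hcacyc⟩ := hS
  set T : Set W := insert x S with hT
  set c' : W → ℕ := fun w => if w = x then 0 else c w with hc'
  have hcS : ∀ w ∈ S, c' w = c w := by
    intro w hw
    have : w ≠ x := fun h => hx (h ▸ hw)
    simp [hc', this]
  set X : ℕ → Set W := fun i => {w ∈ T | c' w = i} with hX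
  have hcx : ∀ w ∈ T, c' w = 0 ↔ w = x := by
    intro w hw
    constructor
    · intro h
      by_contra hwx
      have hwS := hw.resolve_left hwx
      have := (hc w hwS).1
      rw [hcS w hwS] at h
      omega
    · rintro rfl; simp [hc']
  have hXacyc : ∀ i, Acyc r (X i) := by
    intro i
    rcases Nat.eq_zero_or_pos i with rfl | hi
    · refine acyc_of_subsingleton hr ?_
      intro a ha b hb
      rw [(hcx a ha.1).1 ha.2, (hcx b hb.1).1 hb.2]
    · refine (hcacyc i).mono ?_
      rintro w ⟨hw, hwi⟩
      have hwS : w ∈ S := by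
        refine hw.resolve_left fun h => ?_
        have := (hcx w hw).2 h
        omega
      exact ⟨hwS, hcS w hwS ▸ hwi⟩
  obtain ⟨s, hs, hsx⟩ := exists_closing_walk (fwd := fwd) (bwd := bwd) (T := T) (c := c') hr hk
    (Or.inl rfl) hcx (by
      rintro w (rfl | hw)
      · simp [hc']
      · rw [hcS w hw]; exact (hc w hw).2) hXacyc h0 hSx
  obtain ⟨v, hv, hvx⟩ := hsx.last_exit hs
  have hX0 : X 0 = {x} := by
    ext w
    constructor
    · rintro ⟨hw, h⟩; exact (hcx w hw).1 h
    · rintro rfl; exact ⟨Or.inl rfl, (hcx w (Or.inl rfl)).2 rfl⟩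
  obtain ⟨U, hU, hUsub, -⟩ := exists_partialCycle (r := r) (X := X) (k := k)
    (fun i j w hi hj => hi.2.symm.trans hj.2) hX0 (hXacyc 1) (fun i hi => hor i hi.le) hcons le_rfl hv
  set L : Set W := lower r fwd bwd X k with hL
  have hxL : x ∈ L := ⟨0, hk, seed_subset_spread (by change x ∈ X 0; rw [hX0]; rfl)⟩
  obtain ⟨f, Z, f0, fk, hfU, hZU, hinj, hfZ, hZ, hfw, hbw⟩ := hU.exists_sequence
  have hUT : U ⊆ T := by
    intro w hw
    rcases hUsub hw with ⟨j, -, h⟩ | h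
    · exact h.1.1
    · exact (seed_subset h).1
  set V : Set W := (T \ L) \ seed r fwd bwd X k with hV
  have hVS : V ⊆ S := by
    rintro w ⟨⟨hw, hwL⟩, -⟩
    exact hw.resolve_left fun h => hwL (h ▸ hxL)
  have hVU : ∀ w ∈ V, w ∉ U := by
    intro w hw hwU
    rcases hUsub hwU with h | h
    · exact hw.1.2 h
    · exact hw.2 h
  obtain ⟨V₁, hV₁, V₂, hV₂, hV12, hl1, hl2⟩ : Link r (fwd k) (bwd k) v x V := by
    refine link_of_single hlast (hvx.mono ?_)
    rintro w (rfl | ⟨rfl | hw, hw'⟩)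
    · exact Or.inl rfl
    · exact Or.inr (Or.inl rfl)
    · exact Or.inr (Or.inr ⟨hw, hw'⟩)
  rw [Set.disjoint_left] at hV12
  have hVd : ∀ d : Bool, (if d then V₁ else V₂) ⊆ V := by
    intro d; cases d <;> simpa
  refine ⟨fun j => if j ≤ k then f j else x,
    fun j d => if j < k then Z j d else if d then V₁ else V₂, by simpa using f0, by simp,
    ?_, ?_, ?_, ?_, ?_, ?_, ?_⟩
  · intro j hj
    simpa [hj] using hUT (hfU j hj)
  · intro j _ d w hw
    by_cases h1 : j < k <;> simp only [h1, if_true, if_false] at hw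
    · refine (hUT (hZU j h1 d hw)).resolve_left fun h => ?_
      exact hfZ 0 (Nat.zero_le _) j h1 d (f0.trans h.symm ▸ hw)
    · exact hVS (hVd d hw)
  · intro j hj j' hj' h
    simp only [hj, hj', if_true] at h
    exact hinj j hj j' hj' h
  · intro j hj j' _ d
    by_cases h1 : j' < k <;> simp only [h1, hj, if_true, if_false]
    · exact hfZ j hj j' h1 d
    · exact fun h => hVU _ (hVd d h) (hfU j hj)
  · intro j hj d j' hj' d' y hy hy'
    by_cases h1 : j < k <;> by_cases h2 : j' < k <;>
      simp only [h1, h2, if_true, if_false] at hy hy'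
    · exact hZ j h1 d j' h2 d' y hy hy'
    · exact absurd (hZU j h1 d hy) (hVU y (hVd d' hy'))
    · exact absurd (hZU j' h2 d' hy') (hVU y (hVd d hy))
    · refine ⟨by omega, ?_⟩
      cases d <;> cases d' <;> simp only [if_true, Bool.false_eq_true, if_false] at hy hy'
      · rfl
      · exact absurd hy (hV12 hy')
      · exact absurd hy' (hV12 hy)
      · rfl
  · intro j hj hj'
    rcases hj.lt_or_eq with h1 | rfl
    · have h2 : j + 1 ≤ k := h1
      simpa [h1, h1.le, h2] using hfw j h1 hj'
    · simpa [fk] using hl1 hj'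
  · intro j hj hj'
    rcases hj.lt_or_eq with h1 | rfl
    · have h2 : j + 1 ≤ k := h1
      simpa [h1, h1.le, h2] using hbw j h1 hj'
    · simpa [fk] using hl2 hj'

end Recolouring

/-! ### Dichromatic number and induced subdigraphs -/

section Dichromatic

variable {W : Type*}

theorem dichromaticNumber_le_of_colorable {D : Digraph W} {n : ℕ}
    (h : Colorable D.Adj Set.univ n) : dichromaticNumber D ≤ n := by
  obtain ⟨c, hc, hacyc⟩ := h
  refine Nat.sInf_le ⟨fun w => ⟨c w - 1, by have := hc w trivial; omega⟩, fun i => ?_⟩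
  rw [inducesAcyclic_iff]
  refine Acyc.mono (fun w hw => ?_) (hacyc (i + 1))
  have h1 : c w - 1 = i := congrArg Fin.val hw
  have h2 := (hc w trivial).1
  exact ⟨trivial, by omega⟩

theorem colorable_dichromaticNumber [Finite W] {D : Digraph W} (hD : Loopless D) :
    Colorable D.Adj Set.univ (dichromaticNumber D) := by
  have hne : {k : ℕ | ∃ c : W → Fin k, IsAcyclicColoring D c}.Nonempty := by
    refine ⟨Nat.card W, Finite.equivFin W, fun i => ?_⟩
    rw [inducesAcyclic_iff]
    refine acyc_of_subsingleton hD fun a ha b hb => ?_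
    exact (Finite.equivFin W).injective (Eq.trans ha (Eq.symm hb))
  obtain ⟨c, hc⟩ := Nat.sInf_mem hne
  refine ⟨fun w => c w + 1, fun w _ => ⟨Nat.le_add_left 1 _, (c w).isLt⟩, fun i => ?_⟩
  by_cases hi : ∃ w, (c w : ℕ) + 1 = i
  · obtain ⟨w, rfl⟩ := hi
    refine Acyc.mono (fun y hy => ?_) (inducesAcyclic_iff.1 (hc (c w)))
    exact Fin.ext (Nat.succ_injective hy.2)
  · rintro a b ⟨-, ha, -⟩
    exact absurd ⟨a, ha.2⟩ hi

theorem acyc_of_comap {W' : Type*} {φ : W' → W} {r : W → W → Prop} {T : Set W}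
    (hT : T ⊆ Set.range φ) (hφ : Function.Injective φ)
    (h : Acyc (fun a b => r (φ a) (φ b)) (φ ⁻¹' T)) : Acyc r T := by
  have lift : ∀ a y, Conn r T (φ a) y →
      ∃ b, φ b = y ∧ Conn (fun a b => r (φ a) (φ b)) (φ ⁻¹' T) a b := by
    intro a y hy
    induction hy with
    | refl => exact ⟨a, rfl, ReflTransGen.refl⟩
    | tail _ hyz ih =>
      obtain ⟨b, rfl, hab⟩ := ih
      obtain ⟨c, rfl⟩ := hT hyz.2.2
      exact ⟨c, rfl, hab.tail hyz⟩
  intro a b hab hba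
  obtain ⟨a, rfl⟩ := hT hab.2.1
  obtain ⟨b, rfl⟩ := hT hab.2.2
  obtain ⟨a', ha', hba'⟩ := lift b _ hba
  obtain rfl := hφ ha'
  exact h a' b hab hba'

theorem colorable_add {r : W → W → Prop} {S : Set W} {k m : ℕ} (hS : Colorable r S k)
    (hR : Colorable (fun a b : ↥Sᶜ => r a b) Set.univ m) : Colorable r Set.univ (m + k) := by
  classical
  obtain ⟨c, hc, hcacyc⟩ := hS
  obtain ⟨d, hd, hdacyc⟩ := hR
  refine ⟨fun w => if h : w ∈ S then c w else k + d ⟨w, h⟩, fun w _ => ?_, fun i => ?_⟩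
  · by_cases h : w ∈ S
    · have := hc w h
      simp only [h, dite_true]; omega
    · have := hd ⟨w, h⟩ trivial
      simp only [h, dite_false]; omega
  rcases le_or_gt i k with hi | hi
  · refine (hcacyc i).mono ?_
    rintro w ⟨-, hw⟩
    by_cases h : w ∈ S
    · exact ⟨h, by simpa [h] using hw⟩
    · have := hd ⟨w, h⟩ trivial
      simp only [h, dite_false] at hw
      omega
  · have hmem : ∀ w, (if h : w ∈ S then c w else k + d ⟨w, h⟩) = i → w ∉ S := by
      intro w hw h
      have := hc w h
      simp only [h, dite_true] at hw
      omega
    refine acyc_of_comap (φ := ((↑) : ↥Sᶜ → W)) (fun w hw => ⟨⟨w, hmem w hw.2⟩, rfl⟩)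
      Subtype.val_injective ((hdacyc (i - k)).mono ?_)
    rintro ⟨w, hwS⟩ ⟨-, hw⟩
    have h : w ∉ S := hwS
    simp only [h, dite_false] at hw
    refine ⟨trivial, ?_⟩
    omega

/-- A maximal vertex set `S` with an acyclic `k`-colouring leaves a digraph of dichromatic number at
least `M`, so that a subdivision of `F` can be found outside `S`. -/
theorem exists_subdivision_outside {V : Type*} {W : Type} [Finite W] {F : Digraph V} {M k : ℕ}
    (hF : Forces F M) {D : Digraph W} (hD : Loopless D) (hM : M + k ≤ dichromaticNumber D) :
    ∃ S : Set W, Colorable D.Adj S k ∧ (∀ x ∉ S, ¬ Colorable D.Adj (insert x S) k) ∧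
      ∃ (f : V → W) (P : V → V → List W), Function.Injective f ∧ (∀ u, f u ∉ S) ∧
        (∀ u v, ∀ y ∈ P u v, y ∉ S) ∧
        (∀ u v, F.Adj u v → IsDipath D (f u) (f v) (P u v)) ∧
        (∀ u v, F.Adj u v → ∀ w, f w ∈ P u v → w = u ∨ w = v) ∧
        (∀ u v u' v', F.Adj u v → F.Adj u' v' → (u, v) ≠ (u', v') →
          ∀ x, x ∈ P u v → x ∈ P u' v' → x ∈ Set.range f) := by
  have hfin : {S : Set W | Colorable D.Adj S k}.Finite := Set.toFinite _
  obtain ⟨S, hS⟩ := hfin.exists_maximal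
    ⟨∅, fun _ => 1, fun w hw => absurd hw (Set.notMem_empty w), fun _ a _ h => absurd h.2.1.1
      (Set.notMem_empty a)⟩
  let D' : Digraph ↥Sᶜ := ⟨fun a b => D.Adj a b⟩
  have hD' : Loopless D' := fun v => hD v
  have hM' : M ≤ dichromaticNumber D' := by
    have h := dichromaticNumber_le_of_colorable
      (colorable_add hS.1 (colorable_dichromaticNumber hD'))
    omega
  obtain ⟨f, P, hf, hP, hfP, hPP⟩ := hF _ D' hD' hM'
  refine ⟨S, hS.1, fun x hx h => hx (hS.2 h (Set.subset_insert _ _) (Or.inl rfl)),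
    fun u => f u, fun u v => (P u v).map (↑), Subtype.val_injective.comp hf, fun u => (f u).2,
    ?_, ?_, ?_, ?_⟩
  · intro u v y hy
    obtain ⟨z, -, rfl⟩ := List.mem_map.1 hy
    exact z.2
  · intro u v huv
    obtain ⟨h1, h2, h3, h4⟩ := hP u v huv
    refine ⟨h1.map Subtype.val_injective, (List.isChain_map _).2 h2, ?_, ?_⟩
    · rw [List.head?_map, h3]; rfl
    · rw [List.getLast?_map, h4]; rfl
  · intro u v huv w hw
    obtain ⟨z, hz, hzw⟩ := List.mem_map.1 hw
    exact hfP u v huv w (Subtype.val_injective hzw ▸ hz)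
  · intro u v u' v' h h' hne x hx hx'
    obtain ⟨z, hz, rfl⟩ := List.mem_map.1 hx
    obtain ⟨z', hz', he⟩ := List.mem_map.1 hx'
    obtain rfl := Subtype.val_injective he
    obtain ⟨w, hw⟩ := hPP u v u' v' h h' hne z' hz hz'
    exact ⟨w, congrArg Subtype.val hw⟩

end Dichromatic

/-! ### Good digraphs and the attached cycle -/

section Attach

variable {V : Type*} {k : ℕ}

theorem IsGood.adj_consecutive {Q : Digraph (Fin k)} (hQ : IsGood Q) {i : ℕ} (hi : i + 1 < k) :
    Q.Adj ⟨i, by omega⟩ ⟨i + 1, hi⟩ ∨ Q.Adj ⟨i + 1, hi⟩ ⟨i, by omega⟩ := by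
  by_contra hno
  obtain ⟨p⟩ := hQ.connected.preconnected ⟨0, by omega⟩ ⟨i + 1, hi⟩
  have hstep : ∀ a b : Fin k, Q.Adj a b ∨ Q.Adj b a → a.val ≤ i → b.val ≤ i := by
    intro a b hab ha
    by_contra hb
    have hpath : a.val + 1 = b.val ∨ b.val + 1 = a.val := by
      rcases hab with h | h
      · exact SimpleGraph.pathGraph_adj.1 (hQ.le_path h)
      · exact (SimpleGraph.pathGraph_adj.1 (hQ.le_path h)).symm
    have ha' : a = ⟨i, by omega⟩ := Fin.ext (by simp only; omega)
    have hb' : b = ⟨i + 1, hi⟩ := Fin.ext (by simp only; omega)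
    exact hno (ha' ▸ hb' ▸ hab)
  have hwalk : ∀ a b : Fin k, Q.toSimpleGraphInclusive.Walk a b → a.val ≤ i → b.val ≤ i := by
    intro a b p
    induction p with
    | nil => exact id
    | cons h _ ih => exact fun ha => ih (hstep _ _ h.2 ha)
  have := hwalk _ _ p (Nat.zero_le _)
  simp at this

theorem IsGood.not_digon_first {Q : Digraph (Fin k)} (hQ : IsGood Q) (hk : 1 < k) :
    ¬ (Q.Adj ⟨0, by omega⟩ ⟨1, hk⟩ ∧ Q.Adj ⟨1, hk⟩ ⟨0, by omega⟩) := by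
  rintro ⟨h1, h2⟩
  have h := hQ.degree_first hk
  have a1 : 0 < {w | Q.Adj ⟨0, by omega⟩ w}.ncard := (Set.ncard_pos (Set.toFinite _)).2 ⟨_, h1⟩
  have a2 : 0 < {w | Q.Adj w ⟨0, by omega⟩}.ncard := (Set.ncard_pos (Set.toFinite _)).2 ⟨_, h2⟩
  simp only [totalDegree] at h
  omega

theorem IsGood.not_digons_consecutive {Q : Digraph (Fin k)} (hQ : IsGood Q) {a b c : Fin k}
    (hac : a ≠ c) (hab : IsDigon Q a b) : ¬ IsDigon Q b c := by
  intro hbc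
  have hne : s(a, b) ≠ s(b, c) := by
    intro h
    rcases Sym2.eq_iff.1 h with ⟨rfl, rfl⟩ | ⟨h, -⟩
    · exact hac rfl
    · exact hac h
  exact Set.disjoint_left.1 (hQ.digons_disjoint a b b c hab hbc hne) (Or.inr rfl) (Or.inl rfl)

/-- The cycle `v₀ v₁ … v_k v₀` has an arc from its `i`-th vertex to the next one. For `k = 1` the
link from `v_k` back to `v₀` is kept, although `attach F v₀ Q out` has no separate arc for it. -/
def Fwd (Q : Digraph (Fin k)) (out : Bool) (i : ℕ) : Prop :=
  i = 0 ∨ (∃ a b : Fin k, Q.Adj a b ∧ a.val + 1 = i ∧ b.val = i) ∨ (i = k ∧ out = false)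

/-- The cycle `v₀ v₁ … v_k v₀` has an arc to its `i`-th vertex from the next one. -/
def Bwd (Q : Digraph (Fin k)) (out : Bool) (i : ℕ) : Prop :=
  i = 0 ∨ (∃ a b : Fin k, Q.Adj b a ∧ a.val + 1 = i ∧ b.val = i) ∨ (i = k ∧ out = true)

theorem IsGood.fwd_or_bwd {Q : Digraph (Fin k)} (hQ : IsGood Q) (out : Bool) {i : ℕ}
    (hi : i ≤ k) : Fwd Q out i ∨ Bwd Q out i := by
  rcases i with _ | i
  · exact Or.inl (Or.inl rfl)
  rcases hi.lt_or_eq with h | h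
  · rcases hQ.adj_consecutive h with h' | h'
    · exact Or.inl (Or.inr (Or.inl ⟨_, _, h', rfl, rfl⟩))
    · exact Or.inr (Or.inr (Or.inl ⟨_, _, h', rfl, rfl⟩))
  · cases out
    · exact Or.inl (Or.inr (Or.inr ⟨h, rfl⟩))
    · exact Or.inr (Or.inr (Or.inr ⟨h, rfl⟩))

theorem not_fwd_and_bwd_last (Q : Digraph (Fin k)) (out : Bool) (hk : 1 ≤ k) :
    ¬ (Fwd Q out k ∧ Bwd Q out k) := by
  rintro ⟨h1 | ⟨a, b, -, -, hb⟩ | ⟨-, h1⟩, h2 | ⟨a', b', -, -, hb'⟩ | ⟨-, h2⟩⟩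
  any_goals omega
  rw [h1] at h2
  exact absurd h2 (by decide)

theorem isDigon_of_fwd_bwd {Q : Digraph (Fin k)} {out : Bool} {i : ℕ} (hi : i + 1 < k)
    (h : Fwd Q out (i + 1) ∧ Bwd Q out (i + 1)) :
    IsDigon Q ⟨i, by omega⟩ ⟨i + 1, hi⟩ := by
  have e : ∀ a b : Fin k, a.val + 1 = i + 1 → b.val = i + 1 →
      a = ⟨i, by omega⟩ ∧ b = ⟨i + 1, hi⟩ :=
    fun a b ha hb => ⟨Fin.ext (by simp only; omega), Fin.ext hb⟩
  obtain ⟨h1, h2⟩ := h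
  constructor
  · rcases h1 with h1 | ⟨a, b, hab, ha, hb⟩ | h1
    · omega
    · obtain ⟨rfl, rfl⟩ := e a b ha hb
      exact hab
    · omega
  · rcases h2 with h1 | ⟨a, b, hab, ha, hb⟩ | h1
    · omega
    · obtain ⟨rfl, rfl⟩ := e a b ha hb
      exact hab
    · omega

theorem IsGood.not_consecutive {Q : Digraph (Fin k)} (hQ : IsGood Q) (out : Bool) {i : ℕ}
    (hi : i + 1 < k) (h : Fwd Q out i ∧ Bwd Q out i) :
    ¬ (Fwd Q out (i + 1) ∧ Bwd Q out (i + 1)) := by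
  intro h'
  have hd := isDigon_of_fwd_bwd hi h'
  rcases i with _ | i
  · exact hQ.not_digon_first hi hd
  · refine hQ.not_digons_consecutive ?_ (isDigon_of_fwd_bwd (by omega) h) hd
    intro h
    have := congrArg Fin.val h
    simp only at this
    omega

/-- The `i`-th vertex of the cycle `v₀ v₁ … v_k v₀` of `attach F v₀ Q out`. -/
def cycleVertex (v₀ : V) (k i : ℕ) : V ⊕ Fin k :=
  if h : 1 ≤ i ∧ i ≤ k then .inr ⟨i - 1, by omega⟩ else .inl v₀

theorem cycleVertex_succ (v₀ : V) (j : Fin k) : cycleVertex v₀ k (j.val + 1) = .inr j := by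
  have : 1 ≤ j.val + 1 ∧ j.val + 1 ≤ k := by omega
  simp [cycleVertex]

theorem cycleVertex_zero (v₀ : V) : cycleVertex v₀ k 0 = .inl v₀ := by
  simp [cycleVertex]

theorem cycleVertex_last (v₀ : V) : cycleVertex v₀ k (k + 1) = .inl v₀ := by
  simp [cycleVertex]

/-- Every arc of `attach F v₀ Q out` is an arc of `F` or of the cycle `v₀ v₁ … v_k v₀`. -/
theorem attach_adj_cases {F : Digraph V} {v₀ : V} {Q : Digraph (Fin k)} (hQ : IsGood Q)
    {out : Bool} {p q : V ⊕ Fin k} (h : (attach F v₀ Q out).Adj p q) :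
    (∃ u v, p = .inl u ∧ q = .inl v ∧ F.Adj u v) ∨
    (∃ j ≤ k, Fwd Q out j ∧ p = cycleVertex v₀ k j ∧ q = cycleVertex v₀ k (j + 1)) ∨
    (∃ j ≤ k, Bwd Q out j ∧ p = cycleVertex v₀ k (j + 1) ∧ q = cycleVertex v₀ k j) := by
  rcases p with u | i <;> rcases q with v | j
  · exact Or.inl ⟨u, v, rfl, rfl, h⟩
  · obtain ⟨rfl, hj | ⟨-, ho, hj⟩⟩ := h
    · refine Or.inr (Or.inl ⟨0, Nat.zero_le _, Or.inl rfl, (cycleVertex_zero _).symm, ?_⟩)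
      rw [← cycleVertex_succ u j, hj]
    · refine Or.inr (Or.inr ⟨k, le_rfl, Or.inr (Or.inr ⟨rfl, ho⟩), (cycleVertex_last _).symm, ?_⟩)
      rw [← cycleVertex_succ u j, hj]
  · obtain ⟨rfl, hj | ⟨-, ho, hj⟩⟩ := h
    · refine Or.inr (Or.inr ⟨0, Nat.zero_le _, Or.inl rfl, ?_, (cycleVertex_zero _).symm⟩)
      rw [← cycleVertex_succ v i, hj]
    · refine Or.inr (Or.inl ⟨k, le_rfl, Or.inr (Or.inr ⟨rfl, ho⟩), ?_, (cycleVertex_last _).symm⟩)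
      rw [← cycleVertex_succ v i, hj]
  · rcases SimpleGraph.pathGraph_adj.1 (hQ.le_path h) with hij | hij
    · refine Or.inr (Or.inl ⟨j, j.isLt.le, Or.inr (Or.inl ⟨i, j, h, hij, rfl⟩), ?_,
        (cycleVertex_succ _ _).symm⟩)
      rw [← hij, cycleVertex_succ]
    · refine Or.inr (Or.inr ⟨i, i.isLt.le, Or.inr (Or.inl ⟨j, i, h, hij, rfl⟩),
        (cycleVertex_succ _ _).symm, ?_⟩)
      rw [← hij, cycleVertex_succ]

/-- To exhibit a subdivision, it suffices to choose pairwise disjoint sets, free of branch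
vertices, for the inner vertices of the dipaths. -/
theorem containsSubdivision_of_zones {N W : Type*} {G : Digraph N} {D : Digraph W} (f : N → W)
    (Z : N → N → Set W) (hf : Function.Injective f)
    (hP : ∀ u v, G.Adj u v → ∃ l, IsDipath D (f u) (f v) l ∧ ∀ y ∈ l, y = f u ∨ y = f v ∨ y ∈ Z u v)
    (hfZ : ∀ u v w, f w ∉ Z u v)
    (hZ : ∀ u v u' v', ∀ y, y ∈ Z u v → y ∈ Z u' v' → u = u' ∧ v = v') :
    ContainsSubdivision G D := by
  choose! P hPd hPZ using hP
  refine ⟨f, P, hf, hPd, ?_, ?_⟩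
  · intro u v huv w hw
    rcases hPZ u v huv _ hw with h | h | h
    · exact Or.inl (hf h)
    · exact Or.inr (hf h)
    · exact absurd h (hfZ u v w)
  · intro u v u' v' h h' hne y hy hy'
    rcases hPZ u v h y hy with rfl | rfl | h1
    · exact ⟨u, rfl⟩
    · exact ⟨v, rfl⟩
    rcases hPZ u' v' h' y hy' with rfl | rfl | h2
    · exact ⟨u', rfl⟩
    · exact ⟨v', rfl⟩
    obtain ⟨rfl, rfl⟩ := hZ u v u' v' y h1 h2
    exact absurd rfl hne

theorem forces_attach {F : Digraph V} {v₀ : V} {Q : Digraph (Fin k)} (hk : 1 ≤ k)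
    (hQ : IsGood Q) (out : Bool) {M : ℕ} (hF : Forces F M) :
    Forces (attach F v₀ Q out) (M + k) := by
  intro W _ D hD hM
  obtain ⟨S, hS, hSmax, f, P, hf, hfS, hPS, hP, hfP, hPP⟩ := exists_subdivision_outside hF hD hM
  obtain ⟨g, Z, g0, gk, hgS, hZS, hg, hgZ, hZ, hfw, hbw⟩ := exists_cycle (fwd := Fwd Q out)
    (bwd := Bwd Q out) hD hk (hfS v₀) ⟨Or.inl rfl, Or.inl rfl⟩ (fun i hi => hQ.fwd_or_bwd out hi)
    (not_fwd_and_bwd_last Q out hk) (fun i hi h => hQ.not_consecutive out hi h) hS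
    (hSmax _ (hfS v₀))
  have hgS' : ∀ j, 1 ≤ j → j ≤ k → g j ∈ S := by
    intro j h1 h2
    refine (hgS j h2).resolve_left fun h => ?_
    have := hg j h2 0 (Nat.zero_le _) (h.trans g0.symm)
    omega
  set b : V ⊕ Fin k → W := Sum.elim f (fun j => g (j.val + 1)) with hb
  have hbg : ∀ j ≤ k + 1, b (cycleVertex v₀ k j) = g j := by
    intro j hj
    rcases j with _ | j
    · rw [cycleVertex_zero, g0]; rfl
    rcases hj.lt_or_eq with h | h
    · exact congrArg b (cycleVertex_succ v₀ ⟨j, by omega⟩)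
    · rw [h, cycleVertex_last, gk]; rfl
  have hbS : ∀ j : Fin k, b (.inr j) ∈ S := fun j => hgS' _ (by omega) (by omega)
  have hbZ : ∀ p, ∀ j ≤ k, ∀ d, b p ∉ Z j d := by
    rintro (u | i) j hj d h
    · exact hfS u (hZS j hj d h)
    · exact hgZ (i.val + 1) (by omega) j hj d h
  -- The inner vertices of the dipaths: outside `S` for the arcs of `F`, inside `S` for the others.
  let I : V ⊕ Fin k → V ⊕ Fin k → Set W := fun p q =>
    {y | (∃ u v, p = .inl u ∧ q = .inl v ∧ F.Adj u v ∧ y ∈ P u v ∧ y ∉ Set.range f) ∨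
      (∃ j ≤ k, p = cycleVertex v₀ k j ∧ q = cycleVertex v₀ k (j + 1) ∧ y ∈ Z j true) ∨
      (∃ j ≤ k, p = cycleVertex v₀ k (j + 1) ∧ q = cycleVertex v₀ k j ∧ y ∈ Z j false)}
  have hlink : ∀ {y y' : W} {j : ℕ} {d : Bool},
      Conn D.Adj (insert (g j) (insert (g (j + 1)) (Z j d))) y y' →
      y' ∈ insert (g j) (insert (g (j + 1)) (Z j d)) →
      ∃ l, IsDipath D y y' l ∧ ∀ z ∈ l, z = g j ∨ z = g (j + 1) ∨ z ∈ Z j d :=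
    fun h h' => exists_isDipath_of_conn h h'
  refine containsSubdivision_of_zones b I ?_ ?_ ?_ ?_
  · rintro (u | i) (v | j) h
    · exact congrArg _ (hf h)
    · exact absurd (h ▸ hbS j : b (.inl u) ∈ S) (hfS u)
    · exact absurd (h ▸ hbS i : b (.inl v) ∈ S) (hfS v)
    · have := hg (i.val + 1) (by omega) (j.val + 1) (by omega) h
      exact congrArg _ (Fin.ext (by omega))
  · intro p q hpq
    rcases attach_adj_cases hQ hpq with ⟨u, v, rfl, rfl, h⟩ | ⟨j, hj, h, rfl, rfl⟩ |
      ⟨j, hj, h, rfl, rfl⟩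
    · refine ⟨P u v, hP u v h, fun y hy => ?_⟩
      by_cases hyf : y ∈ Set.range f
      · obtain ⟨w, rfl⟩ := hyf
        rcases hfP u v h w hy with rfl | rfl
        · exact Or.inl rfl
        · exact Or.inr (Or.inl rfl)
      · exact Or.inr (Or.inr (Or.inl ⟨u, v, rfl, rfl, h, hy, hyf⟩))
    · rw [hbg j (by omega), hbg (j + 1) (by omega)]
      obtain ⟨l, hl, hlZ⟩ := hlink (hfw j hj h) (Or.inr (Or.inl rfl))
      refine ⟨l, hl, fun y hy => ?_⟩
      rcases hlZ y hy with h | h | h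
      · exact Or.inl h
      · exact Or.inr (Or.inl h)
      · exact Or.inr (Or.inr (Or.inr (Or.inl ⟨j, hj, rfl, rfl, h⟩)))
    · rw [hbg j (by omega), hbg (j + 1) (by omega)]
      obtain ⟨l, hl, hlZ⟩ := hlink (hbw j hj h) (Or.inl rfl)
      refine ⟨l, hl, fun y hy => ?_⟩
      rcases hlZ y hy with h | h | h
      · exact Or.inr (Or.inl h)
      · exact Or.inl h
      · exact Or.inr (Or.inr (Or.inr (Or.inr ⟨j, hj, rfl, rfl, h⟩)))
  · rintro p q w (⟨u, v, -, -, h, hw, hwf⟩ | ⟨j, hj, -, -, h⟩ | ⟨j, hj, -, -, h⟩)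
    · rcases w with w | i
      · exact hwf ⟨w, rfl⟩
      · exact hPS u v _ hw (hbS i)
    · exact hbZ w j hj _ h
    · exact hbZ w j hj _ h
  · rintro p q p' q' y (⟨u, v, rfl, rfl, h, hw, hwf⟩ | ⟨j, hj, rfl, rfl, h⟩ | ⟨j, hj, rfl, rfl, h⟩)
      (⟨u', v', rfl, rfl, h', hw', -⟩ | ⟨j', hj', rfl, rfl, h'⟩ | ⟨j', hj', rfl, rfl, h'⟩)
    · by_contra hne
      refine hwf (hPP u v u' v' h h' ?_ y hw hw')
      rintro heq
      obtain ⟨rfl, rfl⟩ := Prod.mk.inj heq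
      exact hne ⟨rfl, rfl⟩
    · exact absurd (hZS _ hj' _ h') (hPS u v y hw)
    · exact absurd (hZS _ hj' _ h') (hPS u v y hw)
    · exact absurd (hZS _ hj _ h) (hPS u' v' y hw')
    · obtain ⟨rfl, -⟩ := hZ j hj _ j' hj' _ y h h'
      exact ⟨rfl, rfl⟩
    · exact absurd (hZ j hj _ j' hj' _ y h h').2 (by decide)
    · exact absurd (hZS _ hj _ h) (hPS u' v' y hw')
    · exact absurd (hZ j hj _ j' hj' _ y h h').2 (by decide)
    · obtain ⟨rfl, -⟩ := hZ j hj _ j' hj' _ y h h'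
      exact ⟨rfl, rfl⟩

end Attach

end DigraphSubdivision

theorem theorem3p1 {V : Type*} [Finite V] (F : Digraph V)
    (hF : DigraphSubdivision.Loopless F) (v₀ : V) {k : ℕ} (hk : 1 ≤ k)
    (Q : Digraph (Fin k)) (hQ : DigraphSubdivision.IsGood Q) (out : Bool) :
    DigraphSubdivision.mader (DigraphSubdivision.attach F v₀ Q out) ≤
      DigraphSubdivision.mader F + (k : ℕ∞) := by
  rcases Set.eq_empty_or_nonempty {M : ℕ | DigraphSubdivision.Forces F M} with h | h
  · simp [DigraphSubdivision.mader, h]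
  · obtain ⟨M, hM, hMF⟩ := csInf_mem (h.image fun M : ℕ => (M : ℕ∞))
    have hMF : (M : ℕ∞) = DigraphSubdivision.mader F := hMF
    rw [← hMF]
    exact sInf_le ⟨M + k, DigraphSubdivision.forces_attach hk hQ out hM, by push_cast; rfl⟩
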